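/- Let $2^{\mathbb N}$ be the Cantor cube, regarded as the compact group of all $0$–$1$ sequences with coordinatewise addition modulo $2$, with its Haar probability measure $\mu$ (the product of the uniform measures), and with the metric $d(x,y)=2^{-\min\{i:\,x(i)\neq y(i)\}}$ for $x\neq y$. Let $\mathcal N$ be the ideal of all $N\subseteq 2^{\mathbb N}$ with $\mu$-outer measure $0$, and write $A+B=\{a+b:a\in A,\ b\in B\}$. For a nonempty metric space $E$ let $N_E(\delta)\in\mathbb N\cup\{\infty\}$ be the least number of sets of diameter at most $\delta$ needed to cover $E$, and let $\overline{\dim}_B E=\limsup_{\delta\to0+}\frac{\log N_E(\delta)}{|\log\delta|}$ be its upper box dimension (with $\overline{\dim}_B\emptyset=0$). The upper packing dimension of a metric space $E$ is $$\overline{\dim}_P E=\inf\Bigl\{\sup_{n\in\mathbb N}\overline{\dim}_B E_n:\ E=\bigcup_{n\in\mathbb N}E_n\Bigr\}.$$ A separable metric space $X$ is called *upnull* if $\overline{\dim}_P f(X)=0$ for every uniformly continuous mapping $f$ of $X$ into any metric space. The product $2^{\mathbb N}\times2^{\mathbb N}$ carries the maximum metric, and $\mathcal H^1$ denotes the $1$-dimensional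 Hausdorff measure on it. **Theorem.** For every set $X\subseteq 2^{\mathbb N}$ the following are equivalent: 1. $X$ (with the metric inherited from $2^{\mathbb N}$) is upnull; 2. $X$ is $\mathcal N$-additive, i.e. $X+N\in\mathcal N$ for every $N\in\mathcal N$; 3. $X$ is sharply $\mathcal N$-additive, i.e. for every $N\in\mathcal N$ there is a $\sigma$-compact set $F\subseteq 2^{\mathbb N}$ with $X\subseteq F$ and $F+N\in\mathcal N$; 4. $\mathcal H^1(X\times N)=0$ for every $N\in\mathcal N$. -/

import Mathlib

open Set Filter Topology MeasureTheory
open scoped ENNReal Pointwise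

noncomputable section

/-! ### Upper packing dimension and upnull spaces -/

section Packing

universe u

variable {Y : Type u} [MetricSpace Y]

/-- The covering number `N_E(δ)`: the least number of sets of diameter at most `δ` needed to
cover `E` (it is `⊤` if there is no such finite cover). -/
def coveringNum (E : Set Y) (δ : ℝ) : ℕ∞ :=
  ⨅ (C : Set (Set Y)) (_ : E ⊆ ⋃₀ C) (_ : ∀ A ∈ C, Metric.ediam A ≤ ENNReal.ofReal δ), C.encard

/-- The upper box dimension `limsup_{δ → 0+} log N_E(δ) / |log δ|`, with values in `[0, ∞]`.
The truncation `toENNReal` only affects `E = ∅` (where `log 0 = ⊥`), whose dimension is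
thereby `0`; for nonempty `E` one has `N_E(δ) ≥ 1`, so that the logarithm is nonnegative. -/
def upperBoxDim (E : Set Y) : ℝ≥0∞ :=
  limsup (fun δ : ℝ =>
    (ENNReal.log ((coveringNum E δ : ℕ∞) : ℝ≥0∞)).toENNReal / ENNReal.ofReal |Real.log δ|)
    (𝓝[>] (0 : ℝ))

/-- The upper packing dimension: the infimum of `sup_n` of the upper box dimensions of `E_n`
over all countable covers `{E_n}` of `E` by subsets of `E`. -/
def upperPackingDim (E : Set Y) : ℝ≥0∞ :=
  ⨅ (A : ℕ → Set Y) (_ : ⋃ n, A n = E), ⨆ n, upperBoxDim (A n)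

/-- A separable metric space `X` is upnull if each image of `X` under a uniformly continuous
mapping into a metric space has upper packing dimension `0`. (The image has at most the
cardinality of `X`, so target spaces in the universe of `X` represent all images.) -/
def IsUpnull (X : Type u) [MetricSpace X] [TopologicalSpace.SeparableSpace X] : Prop :=
  ∀ (Y : Type u) [MetricSpace Y] (f : X → Y), UniformContinuous f →
    upperPackingDim (range f) = 0

end Packing

/-! ### The Cantor cube -/

/-- The Cantor cube `2^ℕ`, as the group of sequences in `ℤ/2` with coordinatewise addition. -/
def Cantor : Type := ℕ → ZMod 2

namespace Cantor

instance : AddCommGroup Cantor := inferInstanceAs (AddCommGroup (ℕ → ZMod 2))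

/-- The least difference metric: `d(x, y) = 2^{-n}` for `x ≠ y`, where `n` is the least index
with `x n ≠ y n`. -/
instance : MetricSpace Cantor := PiNat.metricSpace (E := fun _ : ℕ => ZMod 2)

instance : MeasurableSpace Cantor := inferInstanceAs (MeasurableSpace (ℕ → ZMod 2))

instance : BorelSpace Cantor := inferInstanceAs (BorelSpace (ℕ → ZMod 2))

instance : CompactSpace Cantor := inferInstanceAs (CompactSpace (ℕ → ZMod 2))

/-- The Haar probability measure on `2^ℕ`, i.e. the product of the uniform measures on `ℤ/2`. -/
def haar : Measure Cantor :=
  Measure.infinitePi (fun _ : ℕ => (PMF.uniformOfFintype (ZMod 2)).toMeasure)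

/-- The ideal `𝒩` of null sets (arbitrary subsets of `2^ℕ` of outer measure zero). -/
def nullIdeal : Set (Set Cantor) := {N | haar N = 0}

/-- `X` is `J`-additive if `X + A ∈ J` for all `A ∈ J`. -/
def IsAdditive (J : Set (Set Cantor)) (X : Set Cantor) : Prop :=
  ∀ A ∈ J, X + A ∈ J

/-- `X` is sharply `J`-additive if for all `A ∈ J` there is a σ-compact `F ⊇ X` with
`F + A ∈ J`. -/
def IsSharplyAdditive (J : Set (Set Cantor)) (X : Set Cantor) : Prop :=
  ∀ A ∈ J, ∃ F : Set Cantor, IsSigmaCompact F ∧ X ⊆ F ∧ F + A ∈ J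

end Cantor

end

/-! ### Cylinders, Haar measure and Hausdorff measure on the Cantor cube -/

/-! All four properties are equivalent to one combinatorial statement, `HasSlaloms`: however fast
`f` grows, the restrictions of points of `X` to the first `f n` coordinates eventually lie in sets
of at most `(n + 1) * 4 ^ n` patterns. What matters is that this width does not depend on `f`.

From slaloms to smallness: a null set is covered infinitely often by unions of cylinders of some
lengths `f n`, of total measure as small as desired, so small that even multiplication by the width
of the slalom leaves a summable series. Borel–Cantelli then gives sharp additivity, and the products
of cylinders give `μH[1] (X ×ˢ N) = 0`. Likewise, if `f` follows a modulus of continuity for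
sufficiently fast decreasing radii, slaloms bound the covering numbers of a uniformly continuous
image and make its dimension zero.

From upnull to slaloms: the map `patterns f` turns agreement on `f n` coordinates into distance of
order `2 ^ (-n)`, so upper packing dimension below 1 bounds the number of patterns on each piece of
a countable cover.

From additive to slaloms (`IsAdditive.hasSlaloms`): take open sets `C n` of measure at most `2 ^
(-n)` whose translates by points with distinct patterns are independent. As `X + limsup C` is null,
a compact set `K` of positive measure avoids it, and Baire's theorem splits `X` into countably many
pieces, each with a fixed relatively open part of `K` missing all its translates of `C n` for large
`n`. By independence, too many patterns in a piece would force that part to have arbitrarily small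
measure.

The condition on `X ×ˢ N` returns to additivity because addition is 1-Lipschitz and Haar measure is
at most `μH[1]`. -/

namespace Cantor

/-- The sequences that agree with `c` at all coordinates in `I`. -/
def cube (I : Finset ℕ) (c : Cantor) : Set Cantor := {z | ∀ i ∈ I, z i = c i}

/-- The sequences that agree with `c` at the first `n` coordinates. -/
def cyl (c : Cantor) (n : ℕ) : Set Cantor := {z | ∀ i < n, z i = c i}

theorem cube_range (c : Cantor) (n : ℕ) : cube (Finset.range n) c = cyl c n := by
  ext z; simp [cube, cyl]

theorem self_mem_cyl (c : Cantor) (n : ℕ) : c ∈ cyl c n := fun _ _ => rfl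

theorem cyl_anti (c : Cantor) {m n : ℕ} (h : m ≤ n) : cyl c n ⊆ cyl c m :=
  fun _ hz i hi => hz i (hi.trans_le h)

theorem mem_cyl_comm {x y : Cantor} {n : ℕ} : x ∈ cyl y n ↔ y ∈ cyl x n :=
  ⟨fun h i hi => (h i hi).symm, fun h i hi => (h i hi).symm⟩

theorem mem_cyl_trans {x y z : Cantor} {n : ℕ} (h : x ∈ cyl y n) (h' : y ∈ cyl z n) :
    x ∈ cyl z n :=
  fun i hi => (h i hi).trans (h' i hi)

theorem add_mem_cyl {x y s t : Cantor} {n : ℕ} (hx : x ∈ cyl s n) (hy : y ∈ cyl t n) :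
    x + y ∈ cyl (s + t) n :=
  fun i hi => congrArg₂ (· + ·) (hx i hi) (hy i hi)

theorem sub_mem_cyl {x y s t : Cantor} {n : ℕ} (hx : x ∈ cyl s n) (hy : y ∈ cyl t n) :
    x - y ∈ cyl (s - t) n :=
  fun i hi => congrArg₂ (· - ·) (hx i hi) (hy i hi)

theorem mem_cyl_iff_dist_le {x y : Cantor} {n : ℕ} : y ∈ cyl x n ↔ dist y x ≤ (1 / 2) ^ n :=
  PiNat.mem_cylinder_iff_dist_le (E := fun _ : ℕ => ZMod 2)

theorem continuous_apply (i : ℕ) : Continuous fun z : Cantor => z i :=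
  _root_.continuous_apply (A := fun _ : ℕ => ZMod 2) i

theorem isClopen_cube (I : Finset ℕ) (c : Cantor) : IsClopen (cube I c) := by
  have : cube I c = ⋂ i ∈ I, (fun z : Cantor => z i) ⁻¹' {c i} := by
    ext z; simp [cube]
  rw [this]
  exact isClopen_biInter_finset fun i _ => (isClopen_discrete _).preimage (continuous_apply i)

theorem isClopen_cyl (c : Cantor) (n : ℕ) : IsClopen (cyl c n) :=
  cube_range c n ▸ isClopen_cube _ c

theorem exists_cyl_subset {U : Set Cantor} (hU : IsOpen U) {z : Cantor} (hz : z ∈ U) :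
    ∃ n, cyl z n ⊆ U := by
  obtain ⟨ε, hε, h⟩ := Metric.isOpen_iff.1 hU z hz
  obtain ⟨n, hn⟩ := exists_pow_lt_of_lt_one hε (by norm_num : (1 / 2 : ℝ) < 1)
  exact ⟨n, fun y hy => h ((mem_cyl_iff_dist_le.1 hy).trans_lt hn)⟩

instance : IsProbabilityMeasure haar :=
  inferInstanceAs (IsProbabilityMeasure
    (Measure.infinitePi fun _ : ℕ => (PMF.uniformOfFintype (ZMod 2)).toMeasure))

theorem haar_cube (I : Finset ℕ) (c : Cantor) : haar (cube I c) = 2⁻¹ ^ I.card := by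
  have h := Measure.infinitePi_pi (fun _ : ℕ => (PMF.uniformOfFintype (ZMod 2)).toMeasure)
    (s := I) (t := fun i => {c i}) (fun i _ => measurableSet_singleton _)
  have h2 : cube I c = (I : Set ℕ).pi fun i => {c i} := by
    ext z; exact Iff.rfl
  rw [h2]
  refine h.trans ?_
  rw [Finset.prod_congr rfl (g := fun _ => (2⁻¹ : ℝ≥0∞)), Finset.prod_const]
  intro i _
  rw [PMF.toMeasure_apply_singleton _ _ (measurableSet_singleton _)]
  simp [ZMod.card]

theorem haar_cyl (c : Cantor) (n : ℕ) : haar (cyl c n) = 2⁻¹ ^ n := by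
  rw [← cube_range, haar_cube, Finset.card_range]

theorem ediam_cyl_le (c : Cantor) (n : ℕ) : Metric.ediam (cyl c n) ≤ 2⁻¹ ^ n := by
  refine Metric.ediam_le fun x hx y hy => ?_
  rw [edist_dist]
  have := mem_cyl_iff_dist_le.1 (mem_cyl_trans hx (mem_cyl_comm.1 hy))
  refine (ENNReal.ofReal_le_ofReal this).trans_eq ?_
  rw [ENNReal.ofReal_pow (by norm_num), one_div, ENNReal.ofReal_inv_of_pos (by norm_num)]
  simp

/-- A set of representatives for the patterns of length `n` that occur in `A`. -/
theorem exists_representatives (A : Set Cantor) (n : ℕ) :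
    ∃ T : Finset Cantor, (T : Set Cantor) ⊆ A ∧ (∀ x ∈ T, ∀ y ∈ T, x ≠ y → y ∉ cyl x n) ∧
      ∀ x ∈ A, ∃ t ∈ T, x ∈ cyl t n := by
  classical
  let p : Cantor → Fin n → ZMod 2 := fun z i => z i
  have hp : ∀ x y, p x = p y ↔ x ∈ cyl y n := fun x y =>
    ⟨fun h i hi => congrFun h ⟨i, hi⟩, fun h => funext fun i => h i i.2⟩
  have hf : (p '' A).Finite := Set.toFinite _
  choose g hg hgp using fun v : p '' A => v.2
  have : Fintype (p '' A) := hf.fintype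
  refine ⟨Finset.univ.image g, ?_, ?_, ?_⟩
  · intro x hx
    obtain ⟨v, -, rfl⟩ := Finset.mem_image.1 (Finset.mem_coe.1 hx)
    exact hg v
  · intro x hx y hy hxy h
    obtain ⟨v, -, rfl⟩ := Finset.mem_image.1 hx
    obtain ⟨w, -, rfl⟩ := Finset.mem_image.1 hy
    have := (hp _ _).2 h
    rw [hgp, hgp] at this
    exact hxy (by rw [Subtype.ext this])
  · intro x hx
    refine ⟨g ⟨p x, x, hx, rfl⟩, Finset.mem_image_of_mem _ (Finset.mem_univ _), ?_⟩
    exact (hp _ _).1 (hgp ⟨p x, x, hx, rfl⟩).symm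

theorem pairwiseDisjoint_cyl {T : Finset Cantor} {n : ℕ}
    (hT : ∀ x ∈ T, ∀ y ∈ T, x ≠ y → y ∉ cyl x n) :
    (T : Set Cantor).PairwiseDisjoint fun t => cyl t n := by
  intro x hx y hy hxy
  refine Set.disjoint_left.2 fun z hzx hzy => hT x hx y hy hxy ?_
  exact mem_cyl_trans (mem_cyl_comm.1 hzy) hzx

theorem haar_biUnion_cyl {T : Finset Cantor} {n : ℕ}
    (hT : ∀ x ∈ T, ∀ y ∈ T, x ≠ y → y ∉ cyl x n) :
    haar (⋃ t ∈ T, cyl t n) = T.card * 2⁻¹ ^ n := by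
  rw [measure_biUnion_finset (pairwiseDisjoint_cyl hT)
    fun t _ => (isClopen_cyl t n).isOpen.measurableSet]
  simp [haar_cyl]

/-- If `k` is the first coordinate at which two points of `s` differ, then `s` lies in a cylinder of
length `k`, of measure `2 ^ (-k)`, while those two points are at distance at least `2 ^ (-k)`. -/
theorem haar_le_ediam (s : Set Cantor) : haar s ≤ Metric.ediam s := by
  rcases s.subsingleton_or_nontrivial with h | h
  · have : haar s = 0 := by
      rcases h.eq_empty_or_singleton with rfl | ⟨x, rfl⟩
      · simp
      · refine le_antisymm (ENNReal.le_of_forall_pos_le_add fun ε hε _ => ?_) zero_le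
        obtain ⟨n, hn⟩ := ENNReal.exists_inv_two_pow_lt (ENNReal.coe_ne_zero.2 hε.ne')
        rw [zero_add]
        calc haar {x} ≤ haar (cyl x n) := measure_mono (by simpa using self_mem_cyl x n)
          _ ≤ ε := by rw [haar_cyl]; exact hn.le
    simp [this]
  · obtain ⟨x, hx, y, hy, hxy⟩ := h
    have hex : ∃ k, ∃ x ∈ s, ∃ y ∈ s, x k ≠ y k := by
      obtain ⟨k, hk⟩ := Function.ne_iff.1 hxy
      exact ⟨k, x, hx, y, hy, hk⟩
    classical
    obtain ⟨x, hx, y, hy, hk⟩ := Nat.find_spec hex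
    have hsub : s ⊆ cyl x (Nat.find hex) := fun z hz i hi => by
      by_contra h
      exact Nat.find_min hex hi ⟨z, hz, x, hx, h⟩
    refine (measure_mono hsub).trans ?_
    rw [haar_cyl]
    refine le_trans ?_ (Metric.edist_le_ediam_of_mem hy hx)
    have hlt : (1 / 2 : ℝ) ^ (Nat.find hex + 1) < dist y x := by
      by_contra h
      exact hk (mem_cyl_iff_dist_le.2 (not_lt.1 h) _ (Nat.lt_succ_self _)).symm
    have hne : y ≠ x := fun h => hk (by rw [h])
    have hd : dist y x = (1 / 2 : ℝ) ^ PiNat.firstDiff (E := fun _ : ℕ => ZMod 2) y x :=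
      PiNat.dist_eq_of_ne (E := fun _ : ℕ => ZMod 2) hne
    rw [hd, pow_lt_pow_iff_right_of_lt_one₀ (by norm_num) (by norm_num)] at hlt
    rw [edist_dist, hd, ENNReal.ofReal_pow (by norm_num), one_div,
      ENNReal.ofReal_inv_of_pos (by norm_num)]
    simp only [ENNReal.ofReal_ofNat]
    exact pow_le_pow_of_le_one zero_le (by simp) (Nat.lt_succ_iff.1 hlt)

theorem haar_le_hausdorffMeasure : haar ≤ μH[1] :=
  Measure.le_hausdorffMeasure 1 haar 1 one_pos fun s _ => by
    rw [ENNReal.rpow_one]; exact haar_le_ediam s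

theorem lipschitzWith_add : LipschitzWith 1 fun p : Cantor × Cantor => p.1 + p.2 := by
  refine LipschitzWith.of_dist_le_mul fun p q => ?_
  rw [NNReal.coe_one, one_mul]
  by_cases h : p.1 + p.2 = q.1 + q.2
  · rw [h, dist_self]; exact dist_nonneg
  · rw [show dist (p.1 + p.2) (q.1 + q.2) = _ from
      PiNat.dist_eq_of_ne (E := fun _ : ℕ => ZMod 2) h]
    set k := PiNat.firstDiff (E := fun _ : ℕ => ZMod 2) (p.1 + p.2) (q.1 + q.2)
    have hk : (p.1 + p.2) k ≠ (q.1 + q.2) k :=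
      PiNat.apply_firstDiff_ne (E := fun _ : ℕ => ZMod 2) h
    have : ∀ x y : Cantor, x k ≠ y k → (1 / 2 : ℝ) ^ k ≤ dist x y := fun x y hxy => by
      by_contra hlt
      exact hxy (PiNat.apply_eq_of_dist_lt (E := fun _ : ℕ => ZMod 2) (not_le.1 hlt) le_rfl)
    rw [Prod.dist_eq]
    by_cases h1 : p.1 k = q.1 k
    · refine le_max_of_le_right (this _ _ fun h2 => hk ?_)
      exact congrArg₂ (· + ·) h1 h2
    · exact le_max_of_le_left (this _ _ h1)

theorem isAdditive_of_hausdorffMeasure_prod {X : Set Cantor}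
    (h : ∀ N ∈ nullIdeal, μH[1] (X ×ˢ N : Set (Cantor × Cantor)) = 0) :
    IsAdditive nullIdeal X := by
  intro N hN
  have h1 := (lipschitzWith_add.lipschitzOnWith (s := X ×ˢ N)).hausdorffMeasure_image_le
    (d := 1) zero_le_one
  rw [h N hN, mul_zero, Set.add_image_prod] at h1
  exact le_antisymm ((haar_le_hausdorffMeasure _).trans h1) zero_le

theorem IsSharplyAdditive.isAdditive {J : Set (Set Cantor)}
    (hJ : ∀ A ∈ J, ∀ B ⊆ A, B ∈ J) {X : Set Cantor} (h : IsSharplyAdditive J X) :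
    IsAdditive J X := by
  intro A hA
  obtain ⟨F, -, hXF, hF⟩ := h A hA
  exact hJ _ hF _ (Set.add_subset_add_right hXF)

/-! ### Slaloms and null sets -/

/-- For every `f`, the restrictions of the elements of `X` to the first `f n` coordinates are
eventually captured by a slalom of the fixed width `(n + 1) * 4 ^ n`. -/
def HasSlaloms (X : Set Cantor) : Prop :=
  ∀ f : ℕ → ℕ, ∃ S : ℕ → Finset Cantor, (∀ n, (S n).card ≤ (n + 1) * 4 ^ n) ∧
    ∀ x ∈ X, ∀ᶠ n in atTop, ∃ s ∈ S n, x ∈ cyl s (f n)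

/-- The largest subset of `V` that is determined by the first `k` coordinates. -/
def cylInterior (V : Set Cantor) (k : ℕ) : Set Cantor := {z | cyl z k ⊆ V}

theorem cylInterior_subset (V : Set Cantor) (k : ℕ) : cylInterior V k ⊆ V :=
  fun z hz => hz (self_mem_cyl z k)

theorem cylInterior_mono (V : Set Cantor) : Monotone (cylInterior V) :=
  fun _ _ h z hz => (cyl_anti z h).trans hz

theorem mem_cylInterior_of_mem_cyl {V : Set Cantor} {k l : ℕ} (hkl : k ≤ l) {y z : Cantor}
    (hz : z ∈ cylInterior V k) (hy : y ∈ cyl z l) : y ∈ cylInterior V k :=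
  fun _ hw => hz (mem_cyl_trans hw (cyl_anti z hkl hy))

theorem isOpen_cylInterior (V : Set Cantor) (k : ℕ) : IsOpen (cylInterior V k) :=
  isOpen_iff_forall_mem_open.2 fun z hz =>
    ⟨cyl z k, fun _ hy => mem_cylInterior_of_mem_cyl le_rfl hz hy, (isClopen_cyl z k).isOpen,
      self_mem_cyl z k⟩

theorem iUnion_cylInterior {V : Set Cantor} (hV : IsOpen V) : ⋃ k, cylInterior V k = V :=
  (iUnion_subset (cylInterior_subset V)).antisymm fun _ hz =>
    mem_iUnion.2 (exists_cyl_subset hV hz)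

theorem tendsto_haar_diff_cylInterior {V : Set Cantor} (hV : IsOpen V) :
    Tendsto (fun k => haar (V \ cylInterior V k)) atTop (𝓝 0) := by
  have h := tendsto_measure_iInter_atTop (μ := haar) (s := fun k => V \ cylInterior V k)
    (fun k => (hV.measurableSet.diff (isOpen_cylInterior V k).measurableSet).nullMeasurableSet)
    (fun _ _ h => sdiff_subset_sdiff_right (cylInterior_mono V h)) ⟨0, measure_ne_top _ _⟩
  rwa [← sdiff_iUnion, iUnion_cylInterior hV, sdiff_self, measure_empty] at h

/-- A null set is contained in the upper limit of a sequence of clopen sets whose measures are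
as small as desired. -/
theorem exists_cyl_cover_of_haar_eq_zero {N : Set Cantor} (hN : haar N = 0) (ε : ℕ → ℝ≥0∞)
    (hε : ∀ n, ε n ≠ 0) :
    ∃ (f : ℕ → ℕ) (T : ℕ → Finset Cantor), (∀ n, n ≤ f n) ∧
      (∀ n, (T n).card * 2⁻¹ ^ f n ≤ ε n) ∧
      ∀ z ∈ N, ∃ᶠ n in atTop, ∃ t ∈ T n, z ∈ cyl t (f n) := by
  have hε' : ∀ n : ℕ, ε n / (n + 1 : ℕ) ≠ 0 := fun n =>
    (ENNReal.div_pos (hε n) (ENNReal.natCast_ne_top _)).ne'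
  choose V hNV hVo hVlt using fun n : ℕ =>
    exists_isOpen_lt_of_lt (μ := haar) N (ε n / (n + 1 : ℕ)) (by
      rw [hN]; exact pos_iff_ne_zero.2 (hε' n))
  -- `K n` is tuned to stage `n + 1`: past level `K n`, what remains undetected of each of `V 0, …,
  -- V n` fits into one of the `n + 2` shares of `ε (n + 1)`.
  have hK : ∀ n : ℕ, ∃ K : ℕ, ∀ k ≥ K, ∀ j ∈ Finset.range (n + 1),
      haar (V j \ cylInterior (V j) k) ≤ ε (n + 1) / (n + 1 + 1 : ℕ) := fun n =>
    eventually_atTop.1 <| (Finset.eventually_all _).2 fun j _ =>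
      (tendsto_haar_diff_cylInterior (hVo j)).eventually_le_const
        (pos_iff_ne_zero.2 (hε' (n + 1)))
  choose K hK using hK
  let f : ℕ → ℕ := fun n => n + ∑ i ∈ Finset.range (n + 1), K i
  have hf : Monotone f := fun m n h => Nat.add_le_add h
    (Finset.sum_le_sum_of_subset (Finset.range_mono (by omega)))
  have hfK : ∀ n, K n ≤ f n := fun n =>
    (Finset.single_le_sum (f := K) (fun _ _ => Nat.zero_le _)
      (Finset.self_mem_range_succ n)).trans (Nat.le_add_left _ _)
  -- Stage `n` collects what level `f n` detects of `V n`, and what it newly detects of the earlier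
  -- `V j`. A point of `V a` thus enters `D n` for some `n ≥ a`. At `n = 0` the truncated `n - 1` is
  -- irrelevant, since the second union is empty.
  let D : ℕ → Set Cantor := fun n => cylInterior (V n) (f n) ∪
    ⋃ j ∈ Finset.range n, (cylInterior (V j) (f n) \ cylInterior (V j) (f (n - 1)))
  have hD : ∀ n, haar (D n) ≤ ε n := fun n => by
    calc haar (D n) ≤ ε n / (n + 1 : ℕ) + ∑ j ∈ Finset.range n, ε n / (n + 1 : ℕ) := by
          refine (measure_union_le _ _).trans (add_le_add ?_ ?_)
          · exact (measure_mono (cylInterior_subset _ _)).trans (hVlt n).le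
          · refine (measure_biUnion_finset_le _ _).trans (Finset.sum_le_sum fun j hj => ?_)
            obtain ⟨m, rfl⟩ : ∃ m, n = m + 1 :=
              Nat.exists_eq_succ_of_ne_zero (by rintro rfl; simp at hj)
            exact (measure_mono (sdiff_subset_sdiff_left (cylInterior_subset _ _))).trans
              (hK m _ (hfK m) j hj)
      _ = (n + 1 : ℕ) * (ε n / (n + 1 : ℕ)) := by
          rw [Finset.sum_const, Finset.card_range, nsmul_eq_mul]; push_cast; ring
      _ ≤ ε n := ENNReal.mul_div_le
  have hDcyl : ∀ n, ∀ z ∈ D n, cyl z (f n) ⊆ D n := by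
    rintro n z (hz | hz) y hy
    · exact Or.inl (mem_cylInterior_of_mem_cyl le_rfl hz hy)
    · simp only [mem_iUnion] at hz
      obtain ⟨j, hj, hz1, hz2⟩ := hz
      refine Or.inr (mem_iUnion₂.2 ⟨j, hj, mem_cylInterior_of_mem_cyl le_rfl hz1 hy, fun h => ?_⟩)
      exact hz2 (mem_cylInterior_of_mem_cyl (hf (Nat.sub_le _ _)) h (mem_cyl_comm.1 hy))
  choose T hTD hT hcov using fun n => exists_representatives (D n) (f n)
  refine ⟨f, T, fun n => Nat.le_add_right _ _, fun n => ?_, fun z hz => ?_⟩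
  · rw [← haar_biUnion_cyl (hT n)]
    exact (measure_mono (iUnion₂_subset fun t ht => hDcyl n t (hTD n ht))).trans (hD n)
  · refine frequently_atTop.2 fun a => ?_
    have hex : ∃ m, z ∈ cylInterior (V a) (f m) := by
      obtain ⟨k, hk⟩ := exists_cyl_subset (hVo a) (hNV a hz)
      exact ⟨k, cylInterior_mono _ (Nat.le_add_right _ _) hk⟩
    classical
    rcases le_or_gt (Nat.find hex) a with h | h
    · exact ⟨a, le_rfl, hcov a z (Or.inl (cylInterior_mono _ (hf h) (Nat.find_spec hex)))⟩
    · exact ⟨_, h.le, hcov _ z (Or.inr (mem_iUnion₂.2 ⟨a, Finset.mem_range.2 h,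
        Nat.find_spec hex, Nat.find_min hex (by omega)⟩))⟩

theorem slalom_mul_le {a b n l : ℕ} (ha : a ≤ (n + 1) * 4 ^ n)
    (hb : (b : ℝ≥0∞) * 2⁻¹ ^ l ≤ 2⁻¹ ^ n / ((n + 1) * 4 ^ n : ℕ)) :
    (a : ℝ≥0∞) * b * 2⁻¹ ^ l ≤ 2⁻¹ ^ n := by
  rw [mul_assoc]
  exact (mul_le_mul' (Nat.cast_le.2 ha) hb).trans ENNReal.mul_div_le

theorem inv_two_pow_div_ne_zero (n m : ℕ) : (2⁻¹ : ℝ≥0∞) ^ n / m ≠ 0 :=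
  (ENNReal.div_pos (by simp) (ENNReal.natCast_ne_top _)).ne'

theorem tsum_inv_two_pow_ne_top : ∑' n : ℕ, (2⁻¹ : ℝ≥0∞) ^ n ≠ ∞ := by
  rw [ENNReal.tsum_geometric]; simp

theorem HasSlaloms.isSharplyAdditive {X : Set Cantor} (hX : HasSlaloms X) :
    IsSharplyAdditive nullIdeal X := by
  intro N hN
  -- The tolerance is `2 ^ (-n)` divided by the width of a slalom. It must be fixed here, before the
  -- slalom exists, because `S` depends on `f` and `f` on `N`.
  obtain ⟨f, T, -, hT, hNT⟩ := exists_cyl_cover_of_haar_eq_zero hN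
    (fun n => 2⁻¹ ^ n / ((n + 1) * 4 ^ n : ℕ)) fun n => inv_two_pow_div_ne_zero _ _
  obtain ⟨S, hS, hXS⟩ := hX f
  refine ⟨⋃ m, ⋂ n ≥ m, ⋃ s ∈ S n, cyl s (f n), ?_, fun x hx => ?_, ?_⟩
  · refine isSigmaCompact_iUnion_of_isCompact _ fun m => IsClosed.isCompact ?_
    exact isClosed_biInter fun n _ =>
      (S n).finite_toSet.isClosed_biUnion fun s _ => (isClopen_cyl s _).isClosed
  · obtain ⟨m, hm⟩ := eventually_atTop.1 (hXS x hx)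
    exact mem_iUnion.2 ⟨m, mem_iInter₂.2 fun n hn => by simpa using hm n hn⟩
  · have h0 : haar (limsup (fun n => ⋃ s ∈ S n, ⋃ t ∈ T n, cyl (s + t) (f n)) atTop) = 0 := by
      refine measure_limsup_atTop_eq_zero
        (ne_top_of_le_ne_top tsum_inv_two_pow_ne_top (ENNReal.tsum_le_tsum fun n => ?_))
      refine le_trans ?_ (slalom_mul_le (hS n) (hT n))
      refine (measure_biUnion_finset_le _ _).trans ?_
      refine (Finset.sum_le_card_nsmul (S n) _ ((T n).card * 2⁻¹ ^ f n : ℝ≥0∞) fun s _ => ?_).trans_eq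
        (by rw [nsmul_eq_mul, mul_assoc])
      refine (measure_biUnion_finset_le _ _).trans ?_
      simp [haar_cyl]
    refine measure_mono_null ?_ h0
    rintro _ ⟨x, hx, z, hz, rfl⟩
    obtain ⟨m, hm⟩ := mem_iUnion.1 hx
    rw [mem_limsup_iff_frequently_mem]
    refine ((hNT z hz).and_eventually (eventually_ge_atTop m)).mono fun n hn => ?_
    obtain ⟨⟨t, ht, hzt⟩, hmn⟩ := hn
    obtain ⟨s, hs, hxs⟩ := mem_iUnion₂.1 (mem_iInter₂.1 hm n hmn)
    exact mem_iUnion₂.2 ⟨s, hs, mem_iUnion₂.2 ⟨t, ht, add_mem_cyl hxs hzt⟩⟩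

theorem HasSlaloms.hausdorffMeasure_prod {X : Set Cantor} (hX : HasSlaloms X)
    {N : Set Cantor} (hN : N ∈ nullIdeal) : μH[1] (X ×ˢ N : Set (Cantor × Cantor)) = 0 := by
  obtain ⟨f, T, hf, hT, hNT⟩ := exists_cyl_cover_of_haar_eq_zero hN
    (fun n => 2⁻¹ ^ n / ((n + 1) * 4 ^ n : ℕ)) fun n => inv_two_pow_div_ne_zero _ _
  obtain ⟨S, hS, hXS⟩ := hX f
  have hdiam : ∀ s t : Cantor, ∀ n, Metric.ediam (cyl s n ×ˢ cyl t n) ≤ 2⁻¹ ^ n :=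
    fun s t n => Metric.ediam_le fun p hp q hq => by
      rw [Prod.edist_eq]
      exact max_le ((Metric.edist_le_ediam_of_mem hp.1 hq.1).trans (ediam_cyl_le s n))
        ((Metric.edist_le_ediam_of_mem hp.2 hq.2).trans (ediam_cyl_le t n))
  -- The `k`-th cover uses only the levels `n + k`; since `n ≤ f n`, its boxes have diameter at most
  -- `2 ^ (-k)`.
  let box : ∀ k : ℕ, (Σ n : ℕ, S (n + k) × T (n + k)) → Set (Cantor × Cantor) :=
    fun k i => cyl i.2.1 (f (i.1 + k)) ×ˢ cyl i.2.2 (f (i.1 + k))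
  have hr : Tendsto (fun k : ℕ => (2⁻¹ : ℝ≥0∞) ^ k) atTop (𝓝 0) :=
    ENNReal.tendsto_pow_atTop_nhds_zero_of_lt_one (by simp)
  have hpow : ∀ {m n : ℕ}, m ≤ n → (2⁻¹ : ℝ≥0∞) ^ n ≤ 2⁻¹ ^ m := fun h =>
    pow_le_pow_of_le_one zero_le (by simp) h
  have h := Measure.hausdorffMeasure_le_liminf_tsum 1 (X ×ˢ N) (fun k : ℕ => 2⁻¹ ^ k) hr box
    (Eventually.of_forall fun k i => (hdiam _ _ _).trans
      (hpow ((Nat.le_add_left _ _).trans (hf _))))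
    (Eventually.of_forall fun k p hp => by
      obtain ⟨n, ⟨⟨t, ht, hz⟩, s, hs, hx⟩, hn⟩ := (((hNT p.2 hp.2).and_eventually
        (hXS p.1 hp.1)).and_eventually (eventually_ge_atTop k)).exists
      obtain ⟨m, rfl⟩ := Nat.exists_eq_add_of_le' hn
      exact mem_iUnion.2 ⟨⟨m, ⟨s, hs⟩, ⟨t, ht⟩⟩, hx, hz⟩)
  refine le_antisymm (h.trans ?_) zero_le
  have hbound : ∀ k, ∑' i, Metric.ediam (box k i) ^ (1 : ℝ) ≤ 2⁻¹ ^ k * ∑' n : ℕ, 2⁻¹ ^ n := by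
    intro k
    rw [ENNReal.tsum_sigma', ← ENNReal.tsum_mul_left]
    refine ENNReal.tsum_le_tsum fun n => ?_
    rw [← pow_add, add_comm k n]
    refine le_trans ?_ (slalom_mul_le (hS (n + k)) (hT (n + k)))
    rw [tsum_fintype]
    refine (Finset.sum_le_card_nsmul _ _ (2⁻¹ ^ f (n + k)) fun i _ => ?_).trans_eq ?_
    · rw [ENNReal.rpow_one]; exact hdiam _ _ _
    · simp
  have hlim : Tendsto (fun k : ℕ => (2⁻¹ : ℝ≥0∞) ^ k * ∑' n : ℕ, 2⁻¹ ^ n) atTop (𝓝 0) := by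
    simpa using ENNReal.Tendsto.mul_const hr (Or.inr tsum_inv_two_pow_ne_top)
  exact (liminf_le_liminf (Eventually.of_forall hbound)).trans hlim.liminf_eq.le

/-- Diagonalization: the slalom at `n` merges the covers of the pieces `0, …, n`, which accounts for
the factor `n + 1` in its width. -/
theorem hasSlaloms_of_forall_exists_pieces {X : Set Cantor}
    (h : ∀ f : ℕ → ℕ, ∃ A : ℕ → Set Cantor, X ⊆ ⋃ j, A j ∧ ∀ j, ∀ᶠ n in atTop,
      ∃ T : Finset Cantor, T.card ≤ 4 ^ n ∧ ∀ x ∈ A j, ∃ t ∈ T, x ∈ cyl t (f n)) :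
    HasSlaloms X := by
  classical
  intro f
  obtain ⟨A, hXA, hA⟩ := h f
  -- A small cover of `A j` may fail to exist for finitely many `n`; the empty set serves there, as
  -- capture is only required eventually.
  have hT : ∀ j n, ∃ T : Finset Cantor, T.card ≤ 4 ^ n ∧
      ((∃ T : Finset Cantor, T.card ≤ 4 ^ n ∧ ∀ x ∈ A j, ∃ t ∈ T, x ∈ cyl t (f n)) →
        ∀ x ∈ A j, ∃ t ∈ T, x ∈ cyl t (f n)) := fun j n => by
    by_cases h : ∃ T : Finset Cantor, T.card ≤ 4 ^ n ∧ ∀ x ∈ A j, ∃ t ∈ T, x ∈ cyl t (f n)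
    · exact ⟨h.choose, h.choose_spec.1, fun _ => h.choose_spec.2⟩
    · exact ⟨∅, by simp, fun h' => absurd h' h⟩
  choose T hTc hT using hT
  refine ⟨fun n => (Finset.range (n + 1)).biUnion fun j => T j n, fun n => ?_, fun x hx => ?_⟩
  · simpa using Finset.card_biUnion_le_card_mul (Finset.range (n + 1)) (fun j => T j n) (4 ^ n)
      fun j _ => hTc j n
  · obtain ⟨j, hj⟩ := mem_iUnion.1 (hXA hx)
    filter_upwards [hA j, eventually_ge_atTop j] with n hn hjn
    obtain ⟨t, ht, hxt⟩ := hT j n hn x hj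
    exact ⟨t, Finset.mem_biUnion.2 ⟨j, Finset.mem_range.2 (by omega), ht⟩, hxt⟩

/-! ### Slaloms and upper packing dimension -/

theorem coveringNum_image_le {X : Set Cantor} {Y : Type} [MetricSpace Y] {φ : X → Y} {k : ℕ}
    {r : ℝ} (hr : ∀ x y : X, (x : Cantor) ∈ cyl y k → dist (φ x) (φ y) ≤ r) {S : Finset Cantor}
    {B : Set X} (hB : ∀ x ∈ B, ∃ s ∈ S, (x : Cantor) ∈ cyl s k) {δ : ℝ} (hδ : r ≤ δ) :
    coveringNum (φ '' B) δ ≤ S.card := by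
  classical
  let C : Finset (Set Y) := S.image fun s => φ '' {x | (x : Cantor) ∈ cyl s k}
  have hC : (C : Set (Set Y)).encard ≤ S.card := by
    rw [Set.encard_coe_eq_coe_finsetCard]
    exact Nat.cast_le.2 Finset.card_image_le
  refine le_trans (iInf_le_of_le (C : Set (Set Y)) (iInf₂_le ?_ ?_)) hC
  · rintro _ ⟨x, hx, rfl⟩
    obtain ⟨s, hs, hxs⟩ := hB x hx
    exact ⟨_, Finset.mem_coe.2 (Finset.mem_image_of_mem _ hs), x, hxs, rfl⟩
  · intro D hD
    obtain ⟨s, -, rfl⟩ := Finset.mem_image.1 (Finset.mem_coe.1 hD)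
    refine Metric.ediam_le ?_
    rintro _ ⟨x, hx, rfl⟩ _ ⟨y, hy, rfl⟩
    rw [edist_dist]
    exact ENNReal.ofReal_le_ofReal ((hr x y (mem_cyl_trans hx (mem_cyl_comm.1 hy))).trans hδ)

theorem toENNReal_log_natCast_le (g : ℕ) :
    (ENNReal.log (g : ℝ≥0∞)).toENNReal ≤ ENNReal.ofReal g := by
  rcases Nat.eq_zero_or_pos g with rfl | hg
  · simp
  · rw [ENNReal.log_pos_real (by exact_mod_cast hg.ne') (ENNReal.natCast_ne_top g),
      EReal.toENNReal_of_ne_top (EReal.coe_ne_top _), EReal.toReal_coe, ENNReal.toReal_natCast]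
    exact ENNReal.ofReal_le_ofReal (Real.log_le_self (Nat.cast_nonneg g))

theorem HasSlaloms.isUpnull {X : Set Cantor} (hX : HasSlaloms X) : IsUpnull X := by
  intro Y _ φ hφ
  let g : ℕ → ℕ := fun n => (n + 1) * 4 ^ n
  have hg : ∀ n, 1 ≤ g n := fun n => Nat.succ_le_of_lt (by positivity)
  -- For `r n ≤ δ < r (n - 1)` the covering number is at most `g n`, whereas `|log δ| > (n - 1) * g
  -- n`. Hence even the crude bound `log (g n) ≤ g n` makes the quotient tend to 0.
  let r : ℕ → ℝ := fun n => Real.exp (-(n * g (n + 1)))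
  have hF : ∀ n, ∃ k, ∀ x y : X, (x : Cantor) ∈ cyl y k → dist (φ x) (φ y) ≤ r n := fun n => by
    obtain ⟨d, hd, h⟩ := Metric.uniformContinuous_iff.1 hφ (r n) (Real.exp_pos _)
    obtain ⟨k, hk⟩ := exists_pow_lt_of_lt_one hd (by norm_num : (1 / 2 : ℝ) < 1)
    exact ⟨k, fun x y hxy => (h ((mem_cyl_iff_dist_le.1 hxy).trans_lt hk)).le⟩
  choose F hF using hF
  obtain ⟨S, hS, hXS⟩ := hX F
  let B : ℕ → Set X := fun m => {x | ∀ n ≥ m, ∃ s ∈ S n, (x : Cantor) ∈ cyl s (F n)}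
  have hB : ⋃ m, φ '' B m = range φ := by
    rw [← image_iUnion, ← image_univ]
    congr 1
    refine eq_univ_of_forall fun x => mem_iUnion.2 ?_
    exact eventually_atTop.1 (hXS x x.2)
  refine le_antisymm (iInf₂_le_of_le (fun m => φ '' B m) hB (iSup_le fun m => ?_)) zero_le
  refine ge_of_tendsto ENNReal.tendsto_inv_nat_nhds_zero
    ((eventually_ge_atTop 1).mono fun K hK => ?_)
  refine limsup_le_of_le (by isBoundedDefault) ?_
  -- This makes the least `n` with `r n ≤ δ` at least `K + m + 2`: then `n ≥ m`, so the slalom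
  -- captures `B m`, and `n - 1 ≥ K`, so the quotient is at most `1 / K`.
  have h1 : ∀ᶠ δ : ℝ in 𝓝[>] 0, ∀ i ∈ Finset.range (K + m + 2), δ < r i :=
    (Finset.eventually_all _).2 fun i _ =>
      (eventually_lt_nhds (Real.exp_pos _)).filter_mono nhdsWithin_le_nhds
  filter_upwards [h1, self_mem_nhdsWithin] with δ hδ hδ0
  have hδ0 : 0 < δ := hδ0
  have hex : ∃ n, r n ≤ δ := by
    obtain ⟨k, hk⟩ := exists_nat_ge (-Real.log δ)
    refine ⟨k, ?_⟩
    rw [← Real.le_log_iff_exp_le hδ0, neg_le]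
    refine hk.trans ?_
    have : (1 : ℝ) ≤ g (k + 1) := Nat.one_le_cast.2 (hg _)
    simpa using le_mul_of_one_le_right (Nat.cast_nonneg k) this
  classical
  have hn := Nat.find_spec hex
  have hnK : K + m + 2 ≤ Nat.find hex := by
    by_contra h
    exact absurd hn (not_le.2 (hδ _ (Finset.mem_range.2 (not_le.1 h))))
  have hmin : δ < r (Nat.find hex - 1) := not_le.1 (Nat.find_min hex (by omega))
  generalize Nat.find hex = n at hn hnK hmin
  have hcov : coveringNum (φ '' B m) δ ≤ (g n : ℕ∞) :=
    (coveringNum_image_le (B := B m) (hF n) (fun x hx => hx n (by omega)) hn).trans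
      (Nat.cast_le.2 (hS n))
  have hlog : (K : ℝ) * g n ≤ |Real.log δ| := by
    obtain ⟨k, rfl⟩ := Nat.exists_eq_add_of_le' (show 1 ≤ n by omega)
    have h2 : Real.log δ < -(k * g (k + 1)) := (Real.log_lt_iff_lt_exp hδ0).2 hmin
    have h3 : (K : ℝ) * g (k + 1) ≤ k * g (k + 1) :=
      mul_le_mul_of_nonneg_right (Nat.cast_le.2 (by omega)) (Nat.cast_nonneg _)
    exact (by linarith : (K : ℝ) * g (k + 1) ≤ -Real.log δ).trans (neg_le_abs _)
  refine ENNReal.div_le_of_le_mul ?_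
  have hcov' : ((coveringNum (φ '' B m) δ : ℕ∞) : ℝ≥0∞) ≤ (g n : ℕ) := by
    exact_mod_cast ENat.toENNReal_le.2 hcov
  refine (EReal.toENNReal_le_toENNReal (ENNReal.log_monotone hcov')).trans ?_
  refine (toENNReal_log_natCast_le _).trans ?_
  calc ENNReal.ofReal (g n) = (K : ℝ≥0∞)⁻¹ * (K * ENNReal.ofReal (g n)) := by
        rw [← mul_assoc, ENNReal.inv_mul_cancel (Nat.cast_ne_zero.2 (by omega))
          (ENNReal.natCast_ne_top K), one_mul]
    _ ≤ _ := by
        refine mul_le_mul_right ?_ _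
        rw [← ENNReal.ofReal_natCast K, ← ENNReal.ofReal_mul (Nat.cast_nonneg K)]
        exact ENNReal.ofReal_le_ofReal hlog

/-- The product of the spaces of patterns of lengths `f 0, f 1, …`, with the least difference
metric. -/
def PatternSpace (f : ℕ → ℕ) : Type := ∀ n, Fin (f n) → ZMod 2

noncomputable instance (f : ℕ → ℕ) : MetricSpace (PatternSpace f) :=
  PiNat.metricSpace (E := fun n => Fin (f n) → ZMod 2)

/-- The sequence of restrictions of `x` to the first `f n` coordinates. -/
def patterns (f : ℕ → ℕ) (x : Cantor) : PatternSpace f := fun _ i => x i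

theorem continuous_patterns (f : ℕ → ℕ) : Continuous (patterns f) :=
  continuous_pi (A := fun n => Fin (f n) → ZMod 2) fun _ => continuous_pi fun i =>
    continuous_apply i

theorem mem_cyl_of_dist_patterns_lt {f : ℕ → ℕ} {n : ℕ} {x y : Cantor}
    (h : dist (patterns f x) (patterns f y) < (1 / 2) ^ n) : x ∈ cyl y (f n) := fun i hi =>
  congrFun (PiNat.apply_eq_of_dist_lt (E := fun n => Fin (f n) → ZMod 2) h le_rfl) ⟨i, hi⟩

/-- At `δ = 2 ^ (-(k + 1))`, a covering number of at least `1 / δ` would make the quotient at least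
1. -/
theorem coveringNum_lt_of_div_lt_one {Y : Type} [MetricSpace Y] {E : Set Y} {k : ℕ}
    (h : (ENNReal.log ((coveringNum E ((1 / 2) ^ (k + 1)) : ℕ∞) : ℝ≥0∞)).toENNReal /
      ENNReal.ofReal |Real.log ((1 / 2) ^ (k + 1))| < 1) :
    coveringNum E ((1 / 2) ^ (k + 1)) < (2 ^ (k + 1) : ℕ) := by
  by_contra! hle
  refine absurd h (not_lt.2 ?_)
  have hlog : |Real.log ((1 / 2 : ℝ) ^ (k + 1))| = Real.log (2 ^ (k + 1)) := by
    rw [one_div, inv_pow, Real.log_inv, abs_neg, abs_of_nonneg]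
    exact Real.log_nonneg (one_le_pow₀ one_le_two)
  have hpos : 0 < Real.log ((2 : ℝ) ^ (k + 1)) :=
    Real.log_pos (one_lt_pow₀ one_lt_two (Nat.succ_ne_zero k))
  rw [hlog, ENNReal.le_div_iff_mul_le (Or.inl (ENNReal.ofReal_pos.2 hpos).ne')
    (Or.inl ENNReal.ofReal_ne_top), one_mul]
  have hle' : ((2 ^ (k + 1) : ℕ) : ℝ≥0∞) ≤
      ((coveringNum E ((1 / 2) ^ (k + 1)) : ℕ∞) : ℝ≥0∞) := by
    exact_mod_cast ENat.toENNReal_le.2 hle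
  refine le_trans ?_ (EReal.toENNReal_le_toENNReal (ENNReal.log_monotone hle'))
  rw [ENNReal.log_pos_real (by simp) (ENNReal.natCast_ne_top _),
    EReal.toENNReal_of_ne_top (EReal.coe_ne_top _), EReal.toReal_coe, ENNReal.toReal_natCast]
  push_cast
  exact le_rfl

theorem hasSlaloms_of_isUpnull {X : Set Cantor} (hX : IsUpnull X) : HasSlaloms X := by
  classical
  refine hasSlaloms_of_forall_exists_pieces fun f => ?_
  let φ : X → PatternSpace f := fun x => patterns f x
  have hφ : UniformContinuous φ :=
    (CompactSpace.uniformContinuous_of_continuous (continuous_patterns f)).comp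
      uniformContinuous_subtype_val
  have hlt : upperPackingDim (range φ) < 1 := by rw [hX _ φ hφ]; exact one_pos
  obtain ⟨A, hlt⟩ := iInf_lt_iff.1 hlt
  obtain ⟨hA, hlt⟩ := iInf_lt_iff.1 hlt
  refine ⟨fun j => {x | x ∈ X ∧ patterns f x ∈ A j}, fun x hx => ?_, fun j => ?_⟩
  · have : φ ⟨x, hx⟩ ∈ ⋃ j, A j := hA ▸ mem_range_self _
    obtain ⟨j, hj⟩ := mem_iUnion.1 this
    exact mem_iUnion.2 ⟨j, hx, hj⟩
  -- The scale is `2 ^ (-(n + 1))` because agreement of the `n`-th patterns needs distance strictly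
  -- below `2 ^ (-n)`. The resulting count `2 ^ (n + 1)` is at most `4 ^ n` once `n ≥ 1`.
  · have hlim : Tendsto (fun n : ℕ => (1 / 2 : ℝ) ^ (n + 1)) atTop (𝓝[>] 0) := by
      refine tendsto_nhdsWithin_iff.2 ⟨?_, Eventually.of_forall fun n => ?_⟩
      · exact (tendsto_add_atTop_iff_nat 1).2
          (tendsto_pow_atTop_nhds_zero_of_lt_one (by norm_num) (by norm_num))
      · exact Set.mem_Ioi.2 (by positivity)
    have hev := hlim.eventually (eventually_lt_of_limsup_lt ((le_iSup _ j).trans_lt hlt))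
    filter_upwards [hev, eventually_ge_atTop 1] with n hn hn1
    have hcov := coveringNum_lt_of_div_lt_one hn
    obtain ⟨C, hcov⟩ := iInf_lt_iff.1 hcov
    obtain ⟨hC, hcov⟩ := iInf_lt_iff.1 hcov
    obtain ⟨hdiam, hcov⟩ := iInf_lt_iff.1 hcov
    have hfin : C.Finite := Set.encard_lt_top_iff.1 (hcov.trans_le le_top)
    have hrep : ∀ B : Set (PatternSpace f), ∃ t : Cantor,
        (∃ t, patterns f t ∈ B) → patterns f t ∈ B := fun B => by
      by_cases h : ∃ t, patterns f t ∈ B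
      · exact ⟨h.choose, fun _ => h.choose_spec⟩
      · exact ⟨0, fun h' => absurd h' h⟩
    choose t ht using hrep
    refine ⟨hfin.toFinset.image t, ?_, fun x hx => ?_⟩
    · refine Finset.card_image_le.trans ?_
      rw [hfin.encard_eq_coe_toFinset_card, Nat.cast_lt] at hcov
      refine hcov.le.trans ?_
      rw [show 4 = 2 ^ 2 by norm_num, ← pow_mul]
      exact Nat.pow_le_pow_right two_pos (by omega)
    · obtain ⟨B, hB, hxB⟩ := hC hx.2
      refine ⟨t B, Finset.mem_image_of_mem _ (hfin.mem_toFinset.2 hB), ?_⟩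
      apply mem_cyl_of_dist_patterns_lt
      have h1 : edist (patterns f x) (patterns f (t B)) ≤ ENNReal.ofReal ((1 / 2) ^ (n + 1)) :=
        (Metric.edist_le_ediam_of_mem hxB (ht B ⟨x, hxB⟩)).trans (hdiam B hB)
      rw [edist_dist, ENNReal.ofReal_le_ofReal_iff (by positivity)] at h1
      exact h1.trans_lt (pow_lt_pow_right_of_lt_one₀ (by norm_num) (by norm_num) (by omega))

/-! ### Independent translates of small open sets -/

theorem measureReal_cube (I : Finset ℕ) (c : Cantor) :
    haar.real (cube I c) = (1 / 2) ^ I.card := by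
  rw [measureReal_def, haar_cube]; simp

theorem cube_inter_cube {I J : Finset ℕ} (h : Disjoint I J) (c d : Cantor) :
    ∃ e, cube I c ∩ cube J d = cube (I ∪ J) e := by
  refine ⟨fun j => if j ∈ I then c j else d j, Set.ext fun z => ?_⟩
  have hJ : ∀ j ∈ J, j ∉ I := fun j hj hi => Finset.disjoint_left.1 h hi hj
  constructor
  · rintro ⟨h1, h2⟩ j hj
    rcases Finset.mem_union.1 hj with hj | hj
    · simpa [hj] using h1 j hj
    · simpa [hJ j hj] using h2 j hj
  · intro hz
    refine ⟨fun j hj => ?_, fun j hj => ?_⟩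
    · simpa [hj] using hz j (Finset.mem_union_left _ hj)
    · simpa [hJ j hj] using hz j (Finset.mem_union_right _ hj)

/-- Cubes with pairwise disjoint supports are independent. -/
theorem measureReal_cube_inter_biInter_compl {ι : Type*} {n : ℕ} {B : ι → Finset ℕ}
    (d : ι → Cantor) (hB : ∀ i, (B i).card = n) (S : Finset ι)
    (hS : (S : Set ι).PairwiseDisjoint B) (I : Finset ℕ) (c : Cantor)
    (hI : ∀ i ∈ S, Disjoint I (B i)) :
    haar.real (cube I c ∩ ⋂ i ∈ S, (cube (B i) (d i))ᶜ) =
      (1 / 2) ^ I.card * (1 - (1 / 2) ^ n) ^ S.card := by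
  classical
  -- `I` and `c` must vary: removing the cube on `B a` subtracts a set of the same form in which
  -- that cube has been absorbed into the one on `I`.
  induction S using Finset.induction_on generalizing I c with
  | empty => simp [measureReal_cube]
  | insert a S ha ih =>
    have hS' : (S : Set ι).PairwiseDisjoint B := hS.subset (by simp)
    obtain ⟨e, he⟩ := cube_inter_cube (hI a (Finset.mem_insert_self _ _)) c (d a)
    have h1 := ih hS' I c fun i hi => hI i (Finset.mem_insert_of_mem hi)
    have h2 := ih hS' (I ∪ B a) e fun i hi => Finset.disjoint_union_left.2
      ⟨hI i (Finset.mem_insert_of_mem hi), hS (by simp) (by simp [hi])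
        (by rintro rfl; exact ha hi)⟩
    rw [Finset.card_union_of_disjoint (hI a (Finset.mem_insert_self _ _)), hB, ← he] at h2
    have h3 := measureReal_inter_add_sdiff (μ := haar)
      (s := cube I c ∩ ⋂ i ∈ S, (cube (B i) (d i))ᶜ)
      (isClopen_cube (B a) (d a)).isOpen.measurableSet
    rw [inter_right_comm, h1, h2] at h3
    rw [Finset.set_biInter_insert, inter_left_comm, inter_comm, ← sdiff_eq,
      Finset.card_insert_of_notMem ha, pow_succ]
    rw [pow_add] at h3
    linear_combination h3

/-- Each pattern of length `l` receives its own block of `n` coordinates beyond `l`, kept apart by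
the pairing function. -/
theorem exists_blocks (l n : ℕ) :
    ∃ blk : Cantor → Finset ℕ, (∀ z, (blk z).card = n) ∧ (∀ z, ∀ p ∈ blk z, l ≤ p) ∧
      (∀ y z, y ∈ cyl z l → blk y = blk z) ∧ ∀ y z, y ∉ cyl z l → Disjoint (blk y) (blk z) := by
  classical
  obtain ⟨e, he⟩ := Countable.exists_injective_nat (Fin l → ZMod 2)
  let p : Cantor → Fin l → ZMod 2 := fun z i => z i
  have hp : ∀ y z, p y = p z ↔ y ∈ cyl z l := fun y z =>
    ⟨fun h i hi => congrFun h ⟨i, hi⟩, fun h => funext fun i => h i i.2⟩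
  refine ⟨fun z => (Finset.range n).image fun i => l + Nat.pair (e (p z)) i, fun z => ?_,
    fun z q hq => ?_, fun y z h => ?_, fun y z h => ?_⟩
  · rw [Finset.card_image_of_injective, Finset.card_range]
    intro i j hij
    exact (Nat.pair_eq_pair.1 (Nat.add_left_cancel hij)).2
  · obtain ⟨i, -, rfl⟩ := Finset.mem_image.1 hq
    exact Nat.le_add_right _ _
  · simp only [(hp y z).2 h]
  · refine Finset.disjoint_left.2 fun q hy hz => h ((hp y z).1 (he ?_))
    obtain ⟨i, -, rfl⟩ := Finset.mem_image.1 hy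
    obtain ⟨j, -, hij⟩ := Finset.mem_image.1 hz
    exact (Nat.pair_eq_pair.1 (Nat.add_left_cancel hij)).1.symm

/-- A small open set whose translates by points with distinct restrictions to the first `l`
coordinates are independent. -/
theorem exists_isOpen_independent_translates (l n : ℕ) :
    ∃ C : Set Cantor, IsOpen C ∧ haar C ≤ 2⁻¹ ^ n ∧
      ∀ S : Finset Cantor, (∀ x ∈ S, ∀ y ∈ S, x ≠ y → y ∉ cyl x l) →
        haar.real {z | ∀ x ∈ S, z - x ∉ C} ≤ (1 - (1 / 2) ^ n) ^ S.card := by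
  classical
  obtain ⟨blk, hcard, hle, heq, hdisj⟩ := exists_blocks l n
  obtain ⟨T, -, hT, hcov⟩ := exists_representatives univ l
  have hdisj' : ∀ z, Disjoint (Finset.range l) (blk z) := fun z =>
    Finset.disjoint_left.2 fun p hp hp' => absurd (Finset.mem_range.1 hp) (hle z p hp').not_gt
  have hTcard : (T.card : ℝ≥0∞) * 2⁻¹ ^ l ≤ 1 := (haar_biUnion_cyl hT).symm.le.trans prob_le_one
  -- Membership in `C` asks `z` to vanish on the block named by its first `l` coordinates. On the
  -- cylinder of `t`, `z - x ∈ C` thus means that `z` agrees with `x` on `blk (t - x)`, and these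
  -- blocks are disjoint for points `x` with distinct patterns.
  refine ⟨{z | z ∈ cube (blk z) 0}, isOpen_iff_forall_mem_open.2 fun z hz => ?_, ?_,
    fun S hS => ?_⟩
  · refine ⟨cyl z l ∩ cube (blk z) 0, fun y hy => ?_,
      (isClopen_cyl z l).isOpen.inter (isClopen_cube _ _).isOpen, self_mem_cyl z l, hz⟩
    rw [mem_ofPred_eq, heq y z hy.1]
    exact hy.2
  · have hsub : {z | z ∈ cube (blk z) 0} ⊆ ⋃ t ∈ T, cube (Finset.range l) t ∩ cube (blk t) 0 := by
      intro z hz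
      obtain ⟨t, ht, hzt⟩ := hcov z (mem_univ z)
      refine mem_iUnion₂.2 ⟨t, ht, (cube_range t l).symm ▸ hzt, ?_⟩
      exact heq z t hzt ▸ hz
    refine (measure_mono hsub).trans ((measure_biUnion_finset_le _ _).trans ?_)
    refine (Finset.sum_le_card_nsmul T _ (2⁻¹ ^ (l + n)) fun t _ => ?_).trans ?_
    · obtain ⟨e, he⟩ := cube_inter_cube (hdisj' t) t 0
      rw [he, haar_cube, Finset.card_union_of_disjoint (hdisj' t), Finset.card_range, hcard]
    · rw [nsmul_eq_mul, pow_add, ← mul_assoc]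
      exact mul_le_of_le_one_left zero_le hTcard
  · have hsub : {z | ∀ x ∈ S, z - x ∉ {z | z ∈ cube (blk z) 0}} ⊆
        ⋃ t ∈ T, (cube (Finset.range l) t ∩ ⋂ x ∈ S, (cube (blk (t - x)) x)ᶜ) := by
      intro z hz
      obtain ⟨t, ht, hzt⟩ := hcov z (mem_univ z)
      refine mem_iUnion₂.2 ⟨t, ht, (cube_range t l).symm ▸ hzt, mem_iInter₂.2 fun x hx h => ?_⟩
      refine hz x hx fun p hp => ?_
      rw [heq (z - x) (t - x) (sub_mem_cyl hzt (self_mem_cyl x l))] at hp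
      exact sub_eq_zero.2 (h p hp)
    have hq : (0 : ℝ) ≤ 1 - (1 / 2) ^ n := sub_nonneg.2 (pow_le_one₀ (by norm_num) (by norm_num))
    refine (measureReal_mono hsub (measure_ne_top _ _)).trans
      ((measureReal_biUnion_finset_le _ _).trans ?_)
    refine (Finset.sum_le_card_nsmul T _
      ((1 / 2) ^ l * (1 - (1 / 2) ^ n) ^ S.card) fun t _ => ?_).trans ?_
    · rw [measureReal_cube_inter_biInter_compl (fun x => x) (fun x => hcard (t - x)) S ?_ _ _
        fun x _ => hdisj' _, Finset.card_range]
      intro x hx y hy hxy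
      refine hdisj _ _ fun h => hS y hy x hx hxy.symm ?_
      simpa only [sub_sub_cancel] using sub_mem_cyl (self_mem_cyl t l) h
    · rw [nsmul_eq_mul, ← mul_assoc]
      refine mul_le_of_le_one_left (pow_nonneg hq _) ?_
      have := ENNReal.toReal_mono ENNReal.one_ne_top hTcard
      simpa using this

/-- This is the source of the bound `4 ^ n`: `(1 - 2 ^ (-n)) ^ (4 ^ n) ≤ exp (-2 ^ n)`, which tends
to 0. -/
theorem eventually_card_le_of_le_pow {η : ℝ} (hη : 0 < η) :
    ∀ᶠ n : ℕ in atTop, ∀ k : ℕ, η ≤ (1 - (1 / 2) ^ n) ^ k → k ≤ 4 ^ n := by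
  have hlim : Tendsto (fun n : ℕ => Real.exp (-2 ^ n)) atTop (𝓝 0) :=
    Real.tendsto_exp_neg_atTop_nhds_zero.comp (tendsto_pow_atTop_atTop_of_one_lt one_lt_two)
  filter_upwards [hlim.eventually_lt_const hη] with n hn k hk
  by_contra! hlt
  have h0 : (0 : ℝ) ≤ 1 - (1 / 2) ^ n := sub_nonneg.2 (pow_le_one₀ (by norm_num) (by norm_num))
  have h1 : (1 - (1 / 2 : ℝ) ^ n) ^ k ≤ Real.exp (-2 ^ n) := by
    calc (1 - (1 / 2 : ℝ) ^ n) ^ k ≤ (1 - (1 / 2) ^ n) ^ (4 ^ n) :=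
          pow_le_pow_of_le_one h0 (sub_le_self _ (by positivity)) hlt.le
      _ ≤ Real.exp (-(1 / 2) ^ n) ^ (4 ^ n) := pow_le_pow_left₀ h0 (Real.one_sub_le_exp_neg _) _
      _ = Real.exp (-2 ^ n) := by
          rw [← Real.exp_nat_mul]
          congr 1
          push_cast
          rw [mul_neg, ← mul_pow]
          norm_num
  linarith

/-! ### From additivity to slaloms -/

/-- A conull set contains a nonempty compact set all of whose nonempty relatively open subsets
have positive measure. -/
theorem exists_isClosed_pos_of_haar_eq_zero {A : Set Cantor} (hA : haar A = 0) :
    ∃ K : Set Cantor, IsClosed K ∧ K.Nonempty ∧ Disjoint K A ∧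
      ∀ U : Set Cantor, IsOpen U → (U ∩ K).Nonempty → 0 < haar (U ∩ K) := by
  have hM : haar (toMeasurable haar A)ᶜ = 1 := by
    rw [prob_compl_eq_one_iff (measurableSet_toMeasurable _ _), measure_toMeasurable, hA]
  obtain ⟨K, hKA, hK, hKpos⟩ := MeasurableSet.exists_lt_isClosed_of_ne_top
    (measurableSet_toMeasurable haar A).compl (measure_ne_top haar _) (hM ▸ one_pos)
  set ν := haar.restrict K
  have hν : haar (K \ ν.support) = 0 := by
    have := Measure.measure_compl_support (μ := ν)
    rwa [Measure.restrict_apply Measure.isClosed_support.measurableSet.compl, inter_comm,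
      ← sdiff_eq] at this
  -- Passing to the support of the restricted measure discards only a null part of `K`.
  refine ⟨K ∩ ν.support, hK.inter Measure.isClosed_support, ?_, ?_, fun U hU hUK => ?_⟩
  · by_contra h
    rw [not_nonempty_iff_eq_empty] at h
    rw [← sdiff_self_inter, h, sdiff_empty] at hν
    exact hKpos.ne' hν
  · exact disjoint_left.2 fun z hz hzA => hKA hz.1 (subset_toMeasurable _ _ hzA)
  · obtain ⟨z, hzU, hzK, hzs⟩ := hUK
    have h1 : 0 < ν U := Measure.mem_support_iff_forall z |>.1 hzs U (hU.mem_nhds hzU)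
    rw [Measure.restrict_apply hU.measurableSet] at h1
    refine h1.trans_le ?_
    calc haar (U ∩ K) ≤ haar (U ∩ (K ∩ ν.support) ∪ K \ ν.support) := measure_mono fun y hy => by
          by_cases h : y ∈ ν.support
          · exact Or.inl ⟨hy.1, hy.2, h⟩
          · exact Or.inr ⟨hy.2, h⟩
      _ ≤ haar (U ∩ (K ∩ ν.support)) + 0 := hν ▸ measure_union_le _ _
      _ = _ := add_zero _

theorem IsAdditive.hasSlaloms {X : Set Cantor} (hX : IsAdditive nullIdeal X) : HasSlaloms X := by
  refine hasSlaloms_of_forall_exists_pieces fun f => ?_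
  choose C hCo hCle hC using fun n => exists_isOpen_independent_translates (f n) n
  have hN : limsup C atTop ∈ nullIdeal := measure_limsup_atTop_eq_zero
    (ne_top_of_le_ne_top tsum_inv_two_pow_ne_top (ENNReal.tsum_le_tsum hCle))
  obtain ⟨K, hK, hKne, hKX, hKpos⟩ := exists_isClosed_pos_of_haar_eq_zero (hX _ hN)
  have hbasis := TopologicalSpace.isBasis_countableBasis Cantor
  obtain ⟨B, hB, -⟩ := hbasis.exists_subset_of_mem_open (mem_univ (0 : Cantor)) isOpen_univ
  obtain ⟨b, hb⟩ := (TopologicalSpace.countable_countableBasis Cantor).exists_eq_range ⟨B, hB⟩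
  have hbo : ∀ i, IsOpen (b i) := fun i => hbasis.isOpen (hb ▸ mem_range_self i)
  -- The index `j` codes a threshold `m` and a basic open set `b i`. Nonemptiness of `b i ∩ K`
  -- excludes the vacuous case and gives this set positive measure.
  refine ⟨fun j => {x | (b j.unpair.2 ∩ K).Nonempty ∧
    ∀ n ≥ j.unpair.1, ∀ z ∈ b j.unpair.2 ∩ K, z - x ∉ C n}, fun x hx => ?_, fun j => ?_⟩
  · have : Nonempty K := hKne.to_subtype
    have : CompactSpace K := isCompact_iff_compactSpace.1 hK.isCompact
    have hclosed : ∀ m : ℕ, IsClosed {z : K | ∀ n ≥ m, (z : Cantor) - x ∉ C n} := fun m => by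
      simp only [ofPred_forall]
      refine isClosed_biInter fun n _ => ((hCo n).preimage ?_).isClosed_compl
      have hsub : Continuous fun z : Cantor => z - x :=
        continuous_pi (A := fun _ : ℕ => ZMod 2) fun i =>
          (_root_.continuous_of_discreteTopology (f := fun a : ZMod 2 => a - x i)).comp
            (continuous_apply i)
      exact hsub.comp continuous_subtype_val
    have hunion : ⋃ m : ℕ, {z : K | ∀ n ≥ m, (z : Cantor) - x ∉ C n} = univ := by
      refine eq_univ_of_forall fun z => mem_iUnion.2 ?_
      have hz : (z : Cantor) - x ∉ limsup C atTop := fun h =>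
        disjoint_left.1 hKX z.2 ⟨x, hx, _, h, add_sub_cancel x (z : Cantor)⟩
      rw [mem_limsup_iff_frequently_mem, not_frequently] at hz
      exact eventually_atTop.1 hz
    -- Baire's theorem in the compact space `K` yields one threshold `m` valid on a whole relatively
    -- open subset.
    obtain ⟨m, p, hp⟩ := nonempty_interior_of_iUnion_of_closed hclosed hunion
    obtain ⟨U, hU, hUi⟩ := isOpen_induced_iff.1
      (isOpen_interior (s := {z : K | ∀ n ≥ m, (z : Cantor) - x ∉ C n}))
    have hpU : (p : Cantor) ∈ U := by rw [← hUi] at hp; exact hp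
    obtain ⟨_, hv, hpv, hvU⟩ := hbasis.exists_subset_of_mem_open hpU hU
    obtain ⟨i, rfl⟩ := hb ▸ hv
    refine mem_iUnion.2 ⟨Nat.pair m i, ?_⟩
    simp only [mem_ofPred_eq, Nat.unpair_pair]
    refine ⟨⟨p, hpv, p.2⟩, fun n hn z hz => ?_⟩
    have hzi : (⟨z, hz.2⟩ : K) ∈ interior {z : K | ∀ n ≥ m, (z : Cantor) - x ∉ C n} := by
      rw [← hUi]; exact hvU hz.1
    exact interior_subset hzi n hn
  · by_cases hne : (b j.unpair.2 ∩ K).Nonempty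
    · have hpos : 0 < haar.real (b j.unpair.2 ∩ K) :=
        ENNReal.toReal_pos (hKpos _ (hbo _) hne).ne' (measure_ne_top _ _)
      filter_upwards [eventually_card_le_of_le_pow hpos, eventually_ge_atTop j.unpair.1]
        with n hn hjn
      obtain ⟨T, hTA, hT, hcov⟩ := exists_representatives
        {x | (b j.unpair.2 ∩ K).Nonempty ∧
          ∀ n ≥ j.unpair.1, ∀ z ∈ b j.unpair.2 ∩ K, z - x ∉ C n} (f n)
      refine ⟨T, hn _ ?_, hcov⟩
      -- A set of fixed positive measure misses all the independent translates of `C n` by points of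
      -- `T`, so its measure is at most `(1 - 2 ^ (-n)) ^ T.card`, which limits `T.card`.
      have hsub : b j.unpair.2 ∩ K ⊆ {z | ∀ x ∈ T, z - x ∉ C n} :=
        fun z hz x hx => (hTA hx).2 n hjn z hz
      exact (measureReal_mono hsub).trans (hC n T hT)
    · exact Eventually.of_forall fun n => ⟨∅, by simp, fun x hx => absurd hx.1 hne⟩

end Cantor

theorem theorem9p1 (X : Set Cantor) :
    List.TFAE [
      IsUpnull X,
      Cantor.IsAdditive Cantor.nullIdeal X,
      Cantor.IsSharplyAdditive Cantor.nullIdeal X,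
      ∀ N ∈ Cantor.nullIdeal, μH[1] (X ×ˢ N : Set (Cantor × Cantor)) = 0] := by
  tfae_have 1 → 3 := fun h => (Cantor.hasSlaloms_of_isUpnull h).isSharplyAdditive
  tfae_have 3 → 2 := fun h => h.isAdditive fun _ hA _ hBA => measure_mono_null hBA hA
  tfae_have 2 → 4 := fun h _ hN => h.hasSlaloms.hausdorffMeasure_prod hN
  tfae_have 4 → 2 := Cantor.isAdditive_of_hausdorffMeasure_prod
  tfae_have 2 → 1 := fun h => h.hasSlaloms.isUpnull
  tfae_finish
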